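/- Let $0<r_1<r_2<\infty$. For $w=w(r,\theta)$ write $\Delta_p w=w_{rr}+\frac1r w_r+\frac1{r^2}w_{\theta\theta}$ (the Laplacian in polar coordinates). Given continuous boundary data on $\{r_1,r_2\}\times\mathbb R$ that is $2\pi$-periodic in $\theta$, consider on the annulus $r_1<|z|<r_2$, in polar coordinates: (D) the Dirichlet problem with data $\varphi$: find $u\in C^2((r_1,r_2)\times\mathbb R)\cap C^0([r_1,r_2]\times\mathbb R)$, $2\pi$-periodic in $\theta$, with $\Delta_p u=0$ in $(r_1,r_2)\times\mathbb R$ and $u=\varphi$ on $\{r_1,r_2\}\times\mathbb R$; (N) the Neumann problem with data $\phi$: find $U\in C^2((r_1,r_2)\times\mathbb R)\cap C^1([r_1,r_2]\times\mathbb R)$ (the gradient extends continuously to the closed strip), $2\pi$-periodic in $\theta$, with $\Delta_p U=0$ in $(r_1,r_2)\times\mathbb R$ and $U_r=\phi$ on $\{r_1,r_2\}\times\mathbb R$ (one-sided derivatives). 1. Let $\phi:\{r_1,r_2\}\times\mathbb R\to\mathbb R$ be continuous, $2\pi$-periodic in $\theta$, and symmetric: $r_1\phi(r_1,\theta)=r_2\phi(r_2,\theta)$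 for all $\theta\in\mathbb R$. If $U$ is a solution of (N) with data $\phi$ and $U(\sqrt{r_1r_2},0)=0$, then (D) with data $\varphi(r,\theta)=r\phi(r,\theta)$ has a unique solution $u$, and $$U(r,\theta)=\int_{\sqrt{r_1r_2}/r}^{1}\frac{u(r\rho,\theta)}{\rho}\,d\rho,\qquad (r,\theta)\in[r_1,r_2]\times\mathbb R .$$ 2. Conversely, let $\varphi:\{r_1,r_2\}\times\mathbb R\to\mathbb R$ be continuous, $2\pi$-periodic in $\theta$, with $\int_0^{2\pi}\varphi(r_1,\theta)\,d\theta=\int_0^{2\pi}\varphi(r_2,\theta)\,d\theta$. If $U$ is a solution of (N) with data $\phi(r,\theta)=\varphi(r,\theta)/r$, then $u(r,\theta)=rU_r(r,\theta)$, $(r,\theta)\in[r_1,r_2]\times\mathbb R$, is the unique solution of (D) with data $\varphi$. -/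

import Mathlib

open Set

/-- The open strip `(r₁, r₂) × ℝ` of polar coordinates `(r, θ)` of the open annulus. -/
def openStrip (r₁ r₂ : ℝ) : Set (ℝ × ℝ) := Ioo r₁ r₂ ×ˢ univ

/-- The closed strip `[r₁, r₂] × ℝ`. -/
def closedStrip (r₁ r₂ : ℝ) : Set (ℝ × ℝ) := Icc r₁ r₂ ×ˢ univ

/-- The Laplace operator in polar coordinates, `w_rr + (1/r) w_r + (1/r²) w_θθ`. -/
noncomputable def polarLaplacian (w : ℝ → ℝ → ℝ) (r θ : ℝ) : ℝ :=
  deriv (fun s => deriv (fun s' => w s' θ) s) r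
    + (1 / r) * deriv (fun s => w s θ) r
    + (1 / r ^ 2) * deriv (fun t => deriv (fun t' => w r t') t) θ

/-- The partial derivative `w_r` on `[r₁, r₂] × ℝ`: the usual one for `r₁ < r < r₂`, and the
one-sided one (from inside the strip) for `r = r₁` and `r = r₂`. -/
noncomputable def radialDeriv (r₁ r₂ : ℝ) (w : ℝ → ℝ → ℝ) (r θ : ℝ) : ℝ :=
  derivWithin (fun s => w s θ) (Icc r₁ r₂) r

/-- Boundary data on `{r₁, r₂} × ℝ`: continuous and `2π`-periodic in the angle.
Only the values `φ r₁ θ` and `φ r₂ θ` matter. -/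
structure IsBoundaryData (r₁ r₂ : ℝ) (φ : ℝ → ℝ → ℝ) : Prop where
  continuous : ∀ r ∈ ({r₁, r₂} : Set ℝ), Continuous (φ r)
  periodic : ∀ r ∈ ({r₁, r₂} : Set ℝ), ∀ θ : ℝ, φ r (θ + 2 * Real.pi) = φ r θ

/-- `u ∈ C²((r₁, r₂) × ℝ) ∩ C⁰([r₁, r₂] × ℝ)` solves the Dirichlet problem in polar coordinates
with boundary values `φ`. Values of `u` outside `[r₁, r₂] × ℝ` are irrelevant. -/
structure IsDirichletSolution (r₁ r₂ : ℝ) (φ : ℝ → ℝ → ℝ) (u : ℝ → ℝ → ℝ) : Prop where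
  contDiffOn : ContDiffOn ℝ 2 (fun p : ℝ × ℝ => u p.1 p.2) (openStrip r₁ r₂)
  continuousOn : ContinuousOn (fun p : ℝ × ℝ => u p.1 p.2) (closedStrip r₁ r₂)
  periodic : ∀ r ∈ Icc r₁ r₂, ∀ θ : ℝ, u r (θ + 2 * Real.pi) = u r θ
  laplace : ∀ r ∈ Ioo r₁ r₂, ∀ θ : ℝ, polarLaplacian u r θ = 0
  boundary : ∀ r ∈ ({r₁, r₂} : Set ℝ), ∀ θ : ℝ, u r θ = φ r θ

/-- `U ∈ C²((r₁, r₂) × ℝ) ∩ C¹([r₁, r₂] × ℝ)` solves the Neumann problem in polar coordinates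
with boundary data `φ`. On the closed convex strip, `ContDiffOn ℝ 1` says exactly that `U` is
continuous, `C¹` inside, and that its gradient extends continuously to the closed strip.
The boundary condition `U_r = φ` holds with the one-sided derivative, which exists. -/
structure IsNeumannSolution (r₁ r₂ : ℝ) (φ : ℝ → ℝ → ℝ) (U : ℝ → ℝ → ℝ) : Prop where
  contDiffOn : ContDiffOn ℝ 2 (fun p : ℝ × ℝ => U p.1 p.2) (openStrip r₁ r₂)
  contDiffOn_closed : ContDiffOn ℝ 1 (fun p : ℝ × ℝ => U p.1 p.2) (closedStrip r₁ r₂)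
  periodic : ∀ r ∈ Icc r₁ r₂, ∀ θ : ℝ, U r (θ + 2 * Real.pi) = U r θ
  laplace : ∀ r ∈ Ioo r₁ r₂, ∀ θ : ℝ, polarLaplacian U r θ = 0
  boundary : ∀ r ∈ ({r₁, r₂} : Set ℝ), ∀ θ : ℝ,
    HasDerivWithinAt (fun s => U s θ) (φ r θ) (Icc r₁ r₂) r

/-- `u` is *the* solution of the Dirichlet problem: it is a solution, and every solution
coincides with it on `[r₁, r₂] × ℝ`. -/
def IsTheDirichletSolution (r₁ r₂ : ℝ) (φ : ℝ → ℝ → ℝ) (u : ℝ → ℝ → ℝ) : Prop :=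
  IsDirichletSolution r₁ r₂ φ u ∧
    ∀ v : ℝ → ℝ → ℝ, IsDirichletSolution r₁ r₂ φ v →
      ∀ r ∈ Icc r₁ r₂, ∀ θ : ℝ, v r θ = u r θ

open Filter Topology InnerProductSpace Laplacian

/-! In the coordinate `z = log r + iθ` the operator `r² Δ_p` is the Euclidean Laplacian and `r ∂_r`
is `∂/∂(re z)`. Real partial derivatives of harmonic functions are harmonic, so for a Neumann
solution `U` the function `u = r U_r` is harmonic, with boundary values `r` times the Neumann data
(`IsNeumannSolution.isDirichletSolution`). Uniqueness is the maximum principle on a strip, with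
periodicity replacing compactness.

For the integral formula, the integral along a ray equals `U(r, θ) - U(√(r₁r₂), θ)`, so `U` must
vanish on the whole middle circle. For symmetric data, uniqueness makes `u` invariant under `r ↦
r₁r₂/r`, a reflection of the strip. Hence `∂u/∂(re z) = 0` on the middle line; there `U_θθ = 0` by
harmonicity, and by periodicity `U` is constant in `θ` (`IsNeumannSolution.eq_on_middle`). -/

/-- A function of polar coordinates, read in the coordinate `z = log r + iθ`. -/
noncomputable def logCoord (w : ℝ → ℝ → ℝ) (z : ℂ) : ℝ := w (Real.exp z.re) z.im

/-- The strip `log r₁ < re z < log r₂`. -/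
def logStrip (r₁ r₂ : ℝ) : Set ℂ := {z | Real.exp z.re ∈ Ioo r₁ r₂}

/-! ### Passage to logarithmic coordinates -/

theorem isOpen_openStrip (r₁ r₂ : ℝ) : IsOpen (openStrip r₁ r₂) := isOpen_Ioo.prod isOpen_univ

theorem isOpen_logStrip (r₁ r₂ : ℝ) : IsOpen (logStrip r₁ r₂) :=
  isOpen_Ioo.preimage (Real.continuous_exp.comp Complex.continuous_re)

/-- The second derivative of a `C²` function along a line. -/
theorem ContDiffAt.deriv_deriv_line {E : Type*} [NormedAddCommGroup E] [NormedSpace ℝ E]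
    {f : E → ℝ} {γ : ℝ → E} {v : E} {t₀ : ℝ} (hf : ContDiffAt ℝ 2 f (γ t₀))
    (hγ : ∀ t, HasDerivAt γ v t) :
    deriv (fun t => deriv (fun s => f (γ s)) t) t₀ = fderiv ℝ (fderiv ℝ f) (γ t₀) v v := by
  have hd : ∀ᶠ x in 𝓝 (γ t₀), DifferentiableAt ℝ f x :=
    (hf.eventually (by simp)).mono fun x hx => hx.differentiableAt (by simp)
  have h1 : (fun t => deriv (fun s => f (γ s)) t) =ᶠ[𝓝 t₀] fun t => fderiv ℝ f (γ t) v := by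
    filter_upwards [(hγ t₀).continuousAt.eventually hd] with t ht
    exact (ht.hasFDerivAt.comp_hasDerivAt t (hγ t)).deriv
  rw [h1.deriv_eq]
  have h2 : DifferentiableAt ℝ (fderiv ℝ f) (γ t₀) :=
    (hf.fderiv_right (m := 1) (by norm_num)).differentiableAt (by simp)
  have h3 := h2.hasFDerivAt.comp_hasDerivAt t₀ (hγ t₀)
  exact (h3.clm_apply (hasDerivAt_const t₀ v)).deriv.trans (by simp)

theorem hasDerivAt_complex_mk_re (b t : ℝ) : HasDerivAt (fun s : ℝ => (⟨s, b⟩ : ℂ)) 1 t := by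
  have : (fun s : ℝ => (⟨s, b⟩ : ℂ)) = fun s : ℝ => (s : ℂ) + b * Complex.I := by
    ext s; exact Complex.mk_eq_add_mul_I s b
  rw [this]
  exact (Complex.ofRealCLM.hasDerivAt (x := t)).add_const _

theorem hasDerivAt_complex_mk_im (a t : ℝ) : HasDerivAt (fun s : ℝ => (⟨a, s⟩ : ℂ)) Complex.I t := by
  have : (fun s : ℝ => (⟨a, s⟩ : ℂ)) = fun s : ℝ => (a : ℂ) + s * Complex.I := by
    ext s; exact Complex.mk_eq_add_mul_I a s
  rw [this]
  simpa using ((Complex.ofRealCLM.hasDerivAt (x := t)).mul_const Complex.I).const_add (a : ℂ)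

/-- The Laplacian of a `C²` function on the complex plane as the sum of its pure second partial
derivatives. -/
theorem ContDiffAt.laplacian_eq_deriv_deriv {f : ℂ → ℝ} {z : ℂ} (hf : ContDiffAt ℝ 2 f z) :
    Δ f z = deriv (fun s => deriv (fun s' => f ⟨s', z.im⟩) s) z.re
      + deriv (fun t => deriv (fun t' => f ⟨z.re, t'⟩) t) z.im := by
  rw [laplacian_eq_iteratedFDeriv_complexPlane,
    ContDiffAt.deriv_deriv_line (γ := fun s : ℝ => (⟨s, z.im⟩ : ℂ)) hf
      (hasDerivAt_complex_mk_re z.im),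
    ContDiffAt.deriv_deriv_line (γ := fun s : ℝ => (⟨z.re, s⟩ : ℂ)) hf
      (hasDerivAt_complex_mk_im z.re)]
  simp [iteratedFDeriv_two_apply]

/-- The second derivative in the logarithmic variable. -/
theorem ContDiffAt.deriv_deriv_comp_exp {h : ℝ → ℝ} {s : ℝ}
    (hh : ContDiffAt ℝ 2 h (Real.exp s)) :
    deriv (fun t => deriv (fun t' => h (Real.exp t')) t) s
      = Real.exp s ^ 2 * deriv (fun x => deriv h x) (Real.exp s)
        + Real.exp s * deriv h (Real.exp s) := by
  have hd : ∀ᶠ x in 𝓝 (Real.exp s), DifferentiableAt ℝ h x :=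
    (hh.eventually (by simp)).mono fun x hx => hx.differentiableAt (by simp)
  have h1 : (fun t => deriv (fun t' => h (Real.exp t')) t) =ᶠ[𝓝 s]
      fun t => deriv h (Real.exp t) * Real.exp t := by
    filter_upwards [(Real.continuous_exp.continuousAt (x := s)).eventually hd] with t ht
    exact (ht.hasDerivAt.comp t (Real.hasDerivAt_exp t)).deriv
  have h2 : DifferentiableAt ℝ (deriv h) (Real.exp s) := by
    have h3 : DifferentiableAt ℝ (fderiv ℝ h) (Real.exp s) :=
      (hh.fderiv_right (m := 1) (by norm_num)).differentiableAt (by simp)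
    exact h3.clm_apply (differentiableAt_const _)
  rw [h1.deriv_eq]
  refine ((h2.hasDerivAt.comp s (Real.hasDerivAt_exp s)).mul (Real.hasDerivAt_exp s)).deriv.trans ?_
  simp only [Function.comp]
  ring

theorem contDiffAt_logCoord {w : ℝ → ℝ → ℝ} {z : ℂ}
    (hw : ContDiffAt ℝ 2 (fun p : ℝ × ℝ => w p.1 p.2) (Real.exp z.re, z.im)) :
    ContDiffAt ℝ 2 (logCoord w) z := by
  have h1 : ContDiffAt ℝ 2 (fun z : ℂ => (Real.exp z.re, z.im)) z :=
    ((Real.contDiff_exp.comp Complex.reCLM.contDiff).prodMk Complex.imCLM.contDiff).contDiffAt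
  exact hw.comp z h1

theorem contDiffAt_of_logCoord {w : ℝ → ℝ → ℝ} {r θ : ℝ} (hr : 0 < r)
    (hw : ContDiffAt ℝ 2 (logCoord w) ⟨Real.log r, θ⟩) :
    ContDiffAt ℝ 2 (fun p : ℝ × ℝ => w p.1 p.2) (r, θ) := by
  have h1 : ContDiffAt ℝ 2 (fun p : ℝ × ℝ => Complex.equivRealProdCLM.symm (Real.log p.1, p.2))
      (r, θ) :=
    Complex.equivRealProdCLM.symm.contDiff.contDiffAt.comp _
      ((contDiffAt_fst.log hr.ne').prodMk contDiffAt_snd)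
  have h2 : Complex.equivRealProdCLM.symm (Real.log r, θ) = (⟨Real.log r, θ⟩ : ℂ) := by
    apply Complex.ext <;> simp
  refine (ContDiffAt.comp (r, θ) (by simpa only [h2] using hw) h1).congr_of_eventuallyEq ?_
  filter_upwards [continuousAt_fst.eventually (lt_mem_nhds hr)] with p hp
  simp [logCoord, Real.exp_log hp]

/-- Differentiating twice through `exp` produces the first-order term `r w_r`, which is exactly the
one in `r² Δ_p`. -/
theorem laplacian_logCoord {w : ℝ → ℝ → ℝ} {z : ℂ}
    (hw : ContDiffAt ℝ 2 (fun p : ℝ × ℝ => w p.1 p.2) (Real.exp z.re, z.im)) :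
    Δ (logCoord w) z = Real.exp z.re ^ 2 * polarLaplacian w (Real.exp z.re) z.im := by
  rw [(contDiffAt_logCoord hw).laplacian_eq_deriv_deriv]
  have h1 : ContDiffAt ℝ 2 (fun r => w r z.im) (Real.exp z.re) :=
    hw.comp (Real.exp z.re) (f := fun r : ℝ => (r, z.im)) (contDiffAt_id.prodMk contDiffAt_const)
  have h2 := h1.deriv_deriv_comp_exp
  simp only [logCoord, polarLaplacian] at *
  rw [h2]
  have := (Real.exp_pos z.re).ne'
  field_simp

theorem log_mem_logStrip {r₁ r₂ r : ℝ} (hr₁ : 0 < r₁) (hr : r ∈ Ioo r₁ r₂) (θ : ℝ) :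
    (⟨Real.log r, θ⟩ : ℂ) ∈ logStrip r₁ r₂ := by
  simpa [logStrip, Real.exp_log (hr₁.trans hr.1)] using hr

theorem harmonicOnNhd_logCoord {r₁ r₂ : ℝ} {w : ℝ → ℝ → ℝ}
    (hw : ContDiffOn ℝ 2 (fun p : ℝ × ℝ => w p.1 p.2) (openStrip r₁ r₂))
    (hl : ∀ r ∈ Ioo r₁ r₂, ∀ θ : ℝ, polarLaplacian w r θ = 0) :
    HarmonicOnNhd (logCoord w) (logStrip r₁ r₂) := by
  have h : ∀ z ∈ logStrip r₁ r₂,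
      ContDiffAt ℝ 2 (fun p : ℝ × ℝ => w p.1 p.2) (Real.exp z.re, z.im) := fun z hz =>
    hw.contDiffAt ((isOpen_openStrip r₁ r₂).mem_nhds ⟨hz, mem_univ _⟩)
  refine fun z hz => ⟨contDiffAt_logCoord (h z hz), ?_⟩
  filter_upwards [(isOpen_logStrip r₁ r₂).mem_nhds hz] with y hy
  rw [laplacian_logCoord (h y hy), hl _ hy, mul_zero, Pi.zero_apply]

/-- Needed for `r U_r`, which a priori is only `C¹` inside: its second derivatives come from
harmonicity. -/
theorem contDiffOn_of_harmonicOnNhd_logCoord {r₁ r₂ : ℝ} (hr₁ : 0 < r₁) {w : ℝ → ℝ → ℝ}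
    (hw : HarmonicOnNhd (logCoord w) (logStrip r₁ r₂)) :
    ContDiffOn ℝ 2 (fun p : ℝ × ℝ => w p.1 p.2) (openStrip r₁ r₂) := fun p hp =>
  (contDiffAt_of_logCoord (hr₁.trans hp.1.1)
    (hw _ (log_mem_logStrip hr₁ hp.1 p.2)).1).contDiffWithinAt

theorem polarLaplacian_eq_zero_of_harmonicOnNhd_logCoord {r₁ r₂ : ℝ} (hr₁ : 0 < r₁)
    {w : ℝ → ℝ → ℝ} (hw : HarmonicOnNhd (logCoord w) (logStrip r₁ r₂))
    {r : ℝ} (hr : r ∈ Ioo r₁ r₂) (θ : ℝ) : polarLaplacian w r θ = 0 := by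
  have hr0 := hr₁.trans hr.1
  have h := hw _ (log_mem_logStrip hr₁ hr θ)
  have h1 := laplacian_logCoord (w := w) (z := ⟨Real.log r, θ⟩)
    (by simpa only [Real.exp_log hr0] using contDiffAt_of_logCoord hr0 h.1)
  rw [h.2.self_of_nhds] at h1
  simp only [Real.exp_log hr0, Pi.zero_apply] at h1
  exact (mul_eq_zero.1 h1.symm).resolve_left (pow_ne_zero 2 hr0.ne')

/-! ### The maximum principle -/

/-- If the second derivative were positive, `x` would also be a local minimum, so `f` would be
constant near `x`. -/
theorem IsLocalMax.deriv_deriv_nonpos {f : ℝ → ℝ} {x : ℝ} (h : IsLocalMax f x)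
    (hc : ContinuousAt f x) : deriv (fun y => deriv f y) x ≤ 0 := by
  by_contra! hpos
  have h1 : IsLocalMin f x := isLocalMin_of_deriv_deriv_pos hpos h.deriv_eq_zero hc
  have h2 : f =ᶠ[𝓝 x] fun _ => f x := by
    filter_upwards [h, h1] with y hy hy' using le_antisymm hy hy'
  have h3 : deriv f =ᶠ[𝓝 x] fun _ => 0 := by
    filter_upwards [h2.eventuallyEq_nhds] with y hy
    rw [hy.deriv_eq, deriv_const]
  rw [h3.deriv_eq, deriv_const] at hpos
  exact lt_irrefl _ hpos

theorem IsLocalMax.laplacian_nonpos {f : ℂ → ℝ} {z : ℂ} (h : IsLocalMax f z)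
    (hf : ContDiffAt ℝ 2 f z) : Δ f z ≤ 0 := by
  rw [hf.laplacian_eq_deriv_deriv]
  have c1 := (hasDerivAt_complex_mk_re z.im z.re).continuousAt
  have c2 := (hasDerivAt_complex_mk_im z.re z.im).continuousAt
  exact add_nonpos
    (IsLocalMax.deriv_deriv_nonpos (f := fun s => f ⟨s, z.im⟩)
      (IsLocalMax.comp_continuous (g := fun s : ℝ => (⟨s, z.im⟩ : ℂ)) h c1)
      (ContinuousAt.comp (f := fun s : ℝ => (⟨s, z.im⟩ : ℂ)) hf.continuousAt c1))
    (IsLocalMax.deriv_deriv_nonpos (f := fun s => f ⟨z.re, s⟩)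
      (IsLocalMax.comp_continuous (g := fun s : ℝ => (⟨z.re, s⟩ : ℂ)) h c2)
      (ContinuousAt.comp (f := fun s : ℝ => (⟨z.re, s⟩ : ℂ)) hf.continuousAt c2))

theorem laplacian_re_sq (z : ℂ) : Δ (fun z : ℂ => z.re ^ 2) z = 2 := by
  have h : ContDiffAt ℝ 2 (fun z : ℂ => z.re ^ 2) z := (Complex.reCLM.contDiff.pow 2).contDiffAt
  rw [h.laplacian_eq_deriv_deriv]
  simp

/-- The weak maximum principle on a strip, for functions periodic along the strip. -/
theorem InnerProductSpace.HarmonicOnNhd.nonpos_of_periodic_strip {a b T : ℝ} (hT : 0 < T)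
    {f : ℂ → ℝ} (hf : HarmonicOnNhd f {z | z.re ∈ Ioo a b})
    (hc : ContinuousOn f {z | z.re ∈ Icc a b})
    (hper : ∀ s ∈ Icc a b, ∀ t : ℝ, f ⟨s, t + T⟩ = f ⟨s, t⟩)
    (ha : ∀ t : ℝ, f ⟨a, t⟩ ≤ 0) (hb : ∀ t : ℝ, f ⟨b, t⟩ ≤ 0)
    {z : ℂ} (hz : z.re ∈ Icc a b) : f z ≤ 0 := by
  by_contra! hpos
  have hD : 0 < a ^ 2 + b ^ 2 + 1 := by positivity
  -- With this `ε`, the perturbation `ε (re z)²` stays below `f z` on both edges, so the maximum of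
  -- `g` cannot lie there.
  obtain ⟨ε, hε, hεz⟩ : ∃ ε, 0 < ε ∧ ε * (a ^ 2 + b ^ 2 + 1) = f z :=
    ⟨f z / (a ^ 2 + b ^ 2 + 1), by positivity, by field_simp⟩
  set q : ℂ → ℝ := fun z => z.re ^ 2
  have hq : ContDiff ℝ 2 q := Complex.reCLM.contDiff.pow 2
  set g : ℂ → ℝ := f + ε • q
  have hgv : ∀ z, g z = f z + ε * z.re ^ 2 := fun z => rfl
  have hgc : ContinuousOn g {z | z.re ∈ Icc a b} := hc.add (hq.continuous.const_smul ε).continuousOn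
  have hKsub : Icc a b ×ℂ Icc 0 T ⊆ {z | z.re ∈ Icc a b} := fun z hz => hz.1
  obtain ⟨z₁, hz₁, hmax⟩ := (isCompact_Icc.reProdIm isCompact_Icc).exists_isMaxOn
    ⟨(⟨z.re, 0⟩ : ℂ), hz, left_mem_Icc.2 hT.le⟩ (hgc.mono hKsub)
  -- Periodicity moves every point of the strip into the compact rectangle.
  have hmax' : ∀ y : ℂ, y.re ∈ Icc a b → g y ≤ g z₁ := by
    intro y hy
    have hp : Function.Periodic (fun t : ℝ => g ⟨y.re, t⟩) T := fun t => by
      simp only [hgv, hper _ hy]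
    obtain ⟨t, ht, hyt⟩ := hp.exists_mem_Ico₀ hT y.im
    have : g y = g ⟨y.re, t⟩ := hyt
    rw [this]
    exact hmax (show (⟨y.re, t⟩ : ℂ) ∈ Icc a b ×ℂ Icc 0 T from ⟨hy, ht.1, ht.2.le⟩)
  have hle : f z ≤ g z₁ := by
    have := hmax' z hz
    rw [hgv z] at this
    nlinarith [mul_nonneg hε.le (sq_nonneg z.re)]
  have hne_a : z₁.re ≠ a := fun h => by
    have h1 := ha z₁.im
    rw [← h] at h1
    rw [hgv, h] at hle
    have : f z₁ ≤ 0 := h1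
    nlinarith [mul_nonneg hε.le (sq_nonneg b)]
  have hne_b : z₁.re ≠ b := fun h => by
    have h1 := hb z₁.im
    rw [← h] at h1
    rw [hgv, h] at hle
    have : f z₁ ≤ 0 := h1
    nlinarith [mul_nonneg hε.le (sq_nonneg a)]
  have hint : z₁.re ∈ Ioo a b :=
    ⟨lt_of_le_of_ne hz₁.1.1 hne_a.symm, lt_of_le_of_ne hz₁.1.2 hne_b⟩
  have hfz := hf z₁ hint
  have hloc : IsLocalMax g z₁ := by
    filter_upwards [(isOpen_Ioo.preimage Complex.continuous_re).mem_nhds hint] with y hy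
    exact hmax' y ⟨hy.1.le, hy.2.le⟩
  have hqε : ContDiffAt ℝ 2 (ε • q) z₁ := hq.contDiffAt.const_smul ε
  have h0 := hloc.laplacian_nonpos (hfz.1.add hqε)
  -- At the interior maximum `Δ g = 0 + 2ε`, which is positive.
  rw [hfz.1.laplacian_add hqε, laplacian_smul _ hq.contDiffAt,
    hfz.2.self_of_nhds, laplacian_re_sq] at h0
  simp only [Pi.zero_apply, smul_eq_mul] at h0
  linarith

/-! ### Uniqueness for the Dirichlet problem -/

theorem logStrip_eq {r₁ r₂ : ℝ} (hr₁ : 0 < r₁) (hr : r₁ < r₂) :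
    logStrip r₁ r₂ = {z | z.re ∈ Ioo (Real.log r₁) (Real.log r₂)} := by
  ext z
  simp [logStrip, Real.log_lt_iff_lt_exp hr₁, Real.lt_log_iff_exp_lt (hr₁.trans hr)]

theorem IsDirichletSolution.harmonicOnNhd {r₁ r₂ : ℝ} {φ u : ℝ → ℝ → ℝ}
    (hu : IsDirichletSolution r₁ r₂ φ u) : HarmonicOnNhd (logCoord u) (logStrip r₁ r₂) :=
  harmonicOnNhd_logCoord hu.contDiffOn hu.laplace

theorem IsDirichletSolution.le {r₁ r₂ : ℝ} (hr₁ : 0 < r₁) (hr : r₁ < r₂) {φ u v : ℝ → ℝ → ℝ}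
    (hu : IsDirichletSolution r₁ r₂ φ u) (hv : IsDirichletSolution r₁ r₂ φ v)
    {r : ℝ} (hrr : r ∈ Icc r₁ r₂) (θ : ℝ) : u r θ ≤ v r θ := by
  have hr₂ := hr₁.trans hr
  have hr0 := hr₁.trans_le hrr.1
  have hmem : ∀ {s}, s ∈ Icc (Real.log r₁) (Real.log r₂) → Real.exp s ∈ Icc r₁ r₂ := fun {s} hs =>
    ⟨(Real.log_le_iff_le_exp hr₁).1 hs.1, (Real.le_log_iff_exp_le hr₂).1 hs.2⟩
  have hcont : ∀ {w}, IsDirichletSolution r₁ r₂ φ w →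
      ContinuousOn (logCoord w) {z | z.re ∈ Icc (Real.log r₁) (Real.log r₂)} := fun {w} hw =>
    hw.continuousOn.comp (f := fun z : ℂ => (Real.exp z.re, z.im))
      ((Real.continuous_exp.comp Complex.continuous_re).prodMk
        Complex.continuous_im).continuousOn (fun z hz => ⟨hmem hz, mem_univ _⟩)
  have hharm := hu.harmonicOnNhd.sub hv.harmonicOnNhd
  rw [logStrip_eq hr₁ hr] at hharm
  have h := hharm.nonpos_of_periodic_strip Real.two_pi_pos ((hcont hu).sub (hcont hv))
    (fun s hs t => by
      simp [logCoord, hu.periodic _ (hmem hs), hv.periodic _ (hmem hs)])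
    (fun t => by
      simp [logCoord, Real.exp_log hr₁, hu.boundary r₁, hv.boundary r₁])
    (fun t => by
      simp [logCoord, Real.exp_log hr₂, hu.boundary r₂, hv.boundary r₂])
    (z := ⟨Real.log r, θ⟩)
    ⟨Real.log_le_log hr₁ hrr.1, Real.log_le_log hr0 hrr.2⟩
  simpa [logCoord, Real.exp_log hr0] using h

theorem IsDirichletSolution.isThe {r₁ r₂ : ℝ} (hr₁ : 0 < r₁) (hr : r₁ < r₂) {φ u : ℝ → ℝ → ℝ}
    (hu : IsDirichletSolution r₁ r₂ φ u) : IsTheDirichletSolution r₁ r₂ φ u :=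
  ⟨hu, fun _ hv _ hrr θ => le_antisymm (hv.le hr₁ hr hu hrr θ) (hu.le hr₁ hr hv hrr θ)⟩

/-! ### From the Neumann to the Dirichlet problem -/

theorem radialDeriv_eq_deriv {r₁ r₂ r : ℝ} (hr : r ∈ Ioo r₁ r₂) (w : ℝ → ℝ → ℝ) (θ : ℝ) :
    radialDeriv r₁ r₂ w r θ = deriv (fun s => w s θ) r :=
  derivWithin_of_mem_nhds (Icc_mem_nhds hr.1 hr.2)

/-- The real partial derivative of a harmonic function is harmonic. -/
theorem InnerProductSpace.HarmonicAt.fderiv_one {f : ℂ → ℝ} {z : ℂ} (hf : HarmonicAt f z) :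
    HarmonicAt (fun z => fderiv ℝ f z 1) z := by
  -- The function `f_x - i f_y` is holomorphic, so its real part is harmonic; no third derivatives
  -- of `f` are assumed.
  have h := (HarmonicAt.analyticAt_complex_partial hf).harmonicAt_re
  simpa using h

theorem logCoord_mul_radialDeriv {r₁ r₂ : ℝ} {w : ℝ → ℝ → ℝ}
    (hw : ContDiffOn ℝ 2 (fun p : ℝ × ℝ => w p.1 p.2) (openStrip r₁ r₂))
    {z : ℂ} (hz : z ∈ logStrip r₁ r₂) :
    logCoord (fun r θ => r * radialDeriv r₁ r₂ w r θ) z = fderiv ℝ (logCoord w) z 1 := by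
  have h1 : ContDiffAt ℝ 2 (fun p : ℝ × ℝ => w p.1 p.2) (Real.exp z.re, z.im) :=
    hw.contDiffAt ((isOpen_openStrip r₁ r₂).mem_nhds ⟨hz, mem_univ _⟩)
  have h2 : DifferentiableAt ℝ (fun r => w r z.im) (Real.exp z.re) :=
    (h1.comp (Real.exp z.re) (f := fun r : ℝ => (r, z.im))
      (contDiffAt_id.prodMk contDiffAt_const)).differentiableAt (by simp)
  have h3 := h2.hasDerivAt.comp z.re (Real.hasDerivAt_exp z.re)
  have h4 := ((contDiffAt_logCoord h1).differentiableAt (by simp)).hasFDerivAt.comp_hasDerivAt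
    z.re (hasDerivAt_complex_mk_re z.im z.re)
  rw [h4.unique h3, logCoord, radialDeriv_eq_deriv hz, mul_comm]

theorem uniqueDiffOn_closedStrip {r₁ r₂ : ℝ} (hr : r₁ < r₂) :
    UniqueDiffOn ℝ (closedStrip r₁ r₂) :=
  (uniqueDiffOn_Icc hr).prod uniqueDiffOn_univ

theorem hasDerivWithinAt_radialDeriv {r₁ r₂ : ℝ} {w : ℝ → ℝ → ℝ}
    (hw : ContDiffOn ℝ 1 (fun p : ℝ × ℝ => w p.1 p.2) (closedStrip r₁ r₂))
    {r : ℝ} (hrr : r ∈ Icc r₁ r₂) (θ : ℝ) :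
    HasDerivWithinAt (fun s => w s θ) (radialDeriv r₁ r₂ w r θ) (Icc r₁ r₂) r := by
  have h : ContDiffOn ℝ 1 (fun s => w s θ) (Icc r₁ r₂) :=
    hw.comp (f := fun s : ℝ => (s, θ)) (contDiff_id.prodMk contDiff_const).contDiffOn
      (fun s hs => (⟨hs, mem_univ θ⟩ : (s, θ) ∈ closedStrip r₁ r₂))
  exact (h.differentiableOn (by simp) r hrr).hasDerivWithinAt

/-- The one-sided derivative is `fderivWithin` on the closed strip applied to `(1, 0)`, hence
continuous up to the edges. -/
theorem continuousOn_radialDeriv {r₁ r₂ : ℝ} (hr : r₁ < r₂) {w : ℝ → ℝ → ℝ}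
    (hw : ContDiffOn ℝ 1 (fun p : ℝ × ℝ => w p.1 p.2) (closedStrip r₁ r₂)) :
    ContinuousOn (fun p : ℝ × ℝ => radialDeriv r₁ r₂ w p.1 p.2) (closedStrip r₁ r₂) := by
  have h := (hw.continuousOn_fderivWithin (uniqueDiffOn_closedStrip hr) (by simp)).clm_apply
    (continuousOn_const (c := ((1 : ℝ), (0 : ℝ))))
  refine h.congr fun p hp => ?_
  have h1 : HasDerivWithinAt (fun s : ℝ => (s, p.2)) ((1 : ℝ), (0 : ℝ)) (Icc r₁ r₂) p.1 :=
    (hasDerivWithinAt_id _ _).prodMk (hasDerivWithinAt_const _ _ _)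
  have h2 := (hw.differentiableOn (by simp) p hp).hasFDerivWithinAt.comp_hasDerivWithinAt p.1 h1
    (fun s hs => (⟨hs, mem_univ p.2⟩ : (s, p.2) ∈ closedStrip r₁ r₂))
  exact h2.derivWithin (uniqueDiffOn_Icc hr p.1 hp.1)

theorem IsNeumannSolution.isDirichletSolution {r₁ r₂ : ℝ} (hr₁ : 0 < r₁) (hr : r₁ < r₂)
    {φ U : ℝ → ℝ → ℝ} (hU : IsNeumannSolution r₁ r₂ φ U) :
    IsDirichletSolution r₁ r₂ (fun r θ => r * φ r θ)
      (fun r θ => r * radialDeriv r₁ r₂ U r θ) := by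
  have hharm : HarmonicOnNhd (logCoord fun r θ => r * radialDeriv r₁ r₂ U r θ)
      (logStrip r₁ r₂) := fun z hz => by
    refine (harmonicAt_congr_nhds ?_).1
      (harmonicOnNhd_logCoord hU.contDiffOn hU.laplace z hz).fderiv_one
    filter_upwards [(isOpen_logStrip r₁ r₂).mem_nhds hz] with y hy
    exact (logCoord_mul_radialDeriv hU.contDiffOn hy).symm
  refine ⟨contDiffOn_of_harmonicOnNhd_logCoord hr₁ hharm,
    continuousOn_fst.mul (continuousOn_radialDeriv hr hU.contDiffOn_closed), fun r hrr θ => ?_,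
    fun r hrr θ => polarLaplacian_eq_zero_of_harmonicOnNhd_logCoord hr₁ hharm hrr θ,
    fun r hrr θ => ?_⟩
  · simp only [radialDeriv]
    rw [derivWithin_congr (fun s hs => hU.periodic s hs θ) (hU.periodic r hrr θ)]
  · have hmem : r ∈ Icc r₁ r₂ := by
      rcases hrr with rfl | rfl
      exacts [left_mem_Icc.2 hr.le, right_mem_Icc.2 hr.le]
    simp only [radialDeriv]
    rw [(hU.boundary r hrr θ).derivWithin (uniqueDiffOn_Icc hr r hmem)]

/-! ### Reflection in the circle of radius `√(r₁ r₂)` -/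

theorem div_mem_Icc {r₁ r₂ r : ℝ} (hr₁ : 0 < r₁) (hrr : r ∈ Icc r₁ r₂) :
    r₁ * r₂ / r ∈ Icc r₁ r₂ := by
  have hr0 := hr₁.trans_le hrr.1
  constructor
  · rw [le_div_iff₀ hr0]; exact mul_le_mul_of_nonneg_left hrr.2 hr₁.le
  · rw [div_le_iff₀ hr0, mul_comm]
    exact mul_le_mul_of_nonneg_left hrr.1 (hr0.le.trans hrr.2)

theorem div_mem_Ioo {r₁ r₂ r : ℝ} (hr₁ : 0 < r₁) (hrr : r ∈ Ioo r₁ r₂) :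
    r₁ * r₂ / r ∈ Ioo r₁ r₂ := by
  have hr0 := hr₁.trans hrr.1
  constructor
  · rw [lt_div_iff₀ hr0]; exact mul_lt_mul_of_pos_left hrr.2 hr₁
  · rw [div_lt_iff₀ hr0, mul_comm]
    exact mul_lt_mul_of_pos_left hrr.1 (hr0.trans hrr.2)

/-- A reflection changes the sign of the first `re`-derivative, but not of the second. -/
theorem InnerProductSpace.HarmonicAt.comp_reflection {f : ℂ → ℝ} {c : ℝ} {z : ℂ}
    (hf : HarmonicAt f ⟨c - z.re, z.im⟩) : HarmonicAt (fun y : ℂ => f ⟨c - y.re, y.im⟩) z := by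
  have hR : ContDiff ℝ 2 fun y : ℂ => (⟨c - y.re, y.im⟩ : ℂ) := by
    have h : (fun y : ℂ => (⟨c - y.re, y.im⟩ : ℂ)) = fun y : ℂ => (c : ℂ) - Complex.conjCLE y := by
      ext y; apply Complex.ext <;> simp
    rw [h]
    exact contDiff_const.sub Complex.conjCLE.contDiff
  refine ⟨hf.1.comp z hR.contDiffAt, ?_⟩
  filter_upwards [hR.continuous.continuousAt.eventually hf.eventually] with y hy
  have hc : ContDiffAt ℝ 2 (fun y : ℂ => f ⟨c - y.re, y.im⟩) y := hy.1.comp y hR.contDiffAt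
  rw [hc.laplacian_eq_deriv_deriv]
  have h := hy.1.laplacian_eq_deriv_deriv
  rw [hy.2.self_of_nhds] at h
  simp only [Pi.zero_apply] at h ⊢
  rw [h]
  congr 1
  have h1 : (fun s => deriv (fun s' => f ⟨c - s', y.im⟩) s)
      = fun s => -deriv (fun s' => f ⟨s', y.im⟩) (c - s) := by
    ext s; exact deriv_comp_const_sub (f := fun s' => f ⟨s', y.im⟩) c s
  rw [h1, deriv.fun_neg, deriv_comp_const_sub (f := fun s => deriv (fun s' => f ⟨s', y.im⟩) s),
    neg_neg]

/-- The inversion swaps the two boundary circles, which carry equal data. -/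
theorem IsDirichletSolution.reflection {r₁ r₂ : ℝ} (hr₁ : 0 < r₁) (hr : r₁ < r₂)
    {φ u : ℝ → ℝ → ℝ} (hu : IsDirichletSolution r₁ r₂ φ u) (hφ : ∀ θ, φ r₁ θ = φ r₂ θ) :
    IsDirichletSolution r₁ r₂ φ (fun r θ => u (r₁ * r₂ / r) θ) := by
  have hr₂ := hr₁.trans hr
  have hexp : ∀ z : ℂ, r₁ * r₂ / Real.exp z.re = Real.exp (Real.log (r₁ * r₂) - z.re) := fun z => by
    rw [Real.exp_sub, Real.exp_log (by positivity)]
  have hharm : HarmonicOnNhd (logCoord fun r θ => u (r₁ * r₂ / r) θ) (logStrip r₁ r₂) := by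
    intro z hz
    have h : logCoord (fun r θ => u (r₁ * r₂ / r) θ)
        = fun y : ℂ => logCoord u ⟨Real.log (r₁ * r₂) - y.re, y.im⟩ := by
      ext y; simp only [logCoord, hexp]
    rw [h]
    refine (hu.harmonicOnNhd _ ?_).comp_reflection
    have := div_mem_Ioo hr₁ hz
    rwa [hexp] at this
  refine ⟨contDiffOn_of_harmonicOnNhd_logCoord hr₁ hharm, ?_,
    fun r hrr θ => hu.periodic _ (div_mem_Icc hr₁ hrr) θ,
    fun r hrr θ => polarLaplacian_eq_zero_of_harmonicOnNhd_logCoord hr₁ hharm hrr θ, ?_⟩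
  · refine hu.continuousOn.comp (f := fun p : ℝ × ℝ => (r₁ * r₂ / p.1, p.2)) ?_
      (fun p hp => ⟨div_mem_Icc hr₁ hp.1, mem_univ _⟩)
    exact (continuousOn_const.div continuousOn_fst
      (fun p hp => (hr₁.trans_le hp.1.1).ne')).prodMk continuousOn_snd
  · rintro r (rfl | rfl) θ
    · rw [mul_div_cancel_left₀ _ hr₁.ne', hφ, hu.boundary _ (by simp)]
    · rw [mul_div_cancel_right₀ _ hr₂.ne', ← hφ, hu.boundary _ (by simp)]

/-- A periodic function with vanishing second derivative is constant. -/
theorem Function.Periodic.eq_of_deriv_deriv_eq_zero {h : ℝ → ℝ} {T : ℝ} (hT : 0 < T)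
    (hp : Function.Periodic h T) (hh : ContDiff ℝ 2 h)
    (h0 : ∀ t, deriv (fun t => deriv h t) t = 0) (x y : ℝ) : h x = h y := by
  have hd : Differentiable ℝ h := hh.differentiable (by simp)
  have hd' : Differentiable ℝ (deriv h) :=
    ((contDiff_succ_iff_deriv (n := 1)).1 hh).2.2.differentiable (by simp)
  have hc : ∀ t, deriv h t = deriv h 0 := fun t => is_const_of_deriv_eq_zero hd' h0 t 0
  -- Rolle over one period: the constant `deriv h` has a zero.
  obtain ⟨c, -, hc0⟩ := exists_deriv_eq_zero hT hd.continuous.continuousOn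
    (by simpa using (hp 0).symm)
  exact is_const_of_deriv_eq_zero hd (fun t => by rw [hc, ← hc c, hc0]) x y

/-! ### Constancy on the middle circle -/

theorem sqrt_mul_mem_Ioo {r₁ r₂ : ℝ} (hr₁ : 0 < r₁) (hr : r₁ < r₂) :
    Real.sqrt (r₁ * r₂) ∈ Ioo r₁ r₂ := by
  constructor
  · exact Real.lt_sqrt_of_sq_lt (by nlinarith)
  · exact (Real.sqrt_lt' (hr₁.trans hr)).2 (by nlinarith)

/-- For symmetric data, a solution of the Neumann problem is constant on the middle circle. -/
theorem IsNeumannSolution.eq_on_middle {r₁ r₂ : ℝ} (hr₁ : 0 < r₁) (hr : r₁ < r₂)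
    {φ U : ℝ → ℝ → ℝ} (hU : IsNeumannSolution r₁ r₂ φ U)
    (hφ : ∀ θ : ℝ, r₁ * φ r₁ θ = r₂ * φ r₂ θ) (θ θ' : ℝ) :
    U (Real.sqrt (r₁ * r₂)) θ = U (Real.sqrt (r₁ * r₂)) θ' := by
  have hr₂ := hr₁.trans hr
  have hmid := sqrt_mul_mem_Ioo hr₁ hr
  set ρ := Real.sqrt (r₁ * r₂)
  have hρ0 : 0 < ρ := hr₁.trans hmid.1
  have hρ2 : r₁ * r₂ = ρ ^ 2 := (Real.sq_sqrt (by positivity)).symm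
  have hu := hU.isDirichletSolution hr₁ hr
  -- The reflected solution has the same data, so uniqueness applies.
  have hsym : ∀ r ∈ Icc r₁ r₂, ∀ t, r₁ * r₂ / r * radialDeriv r₁ r₂ U (r₁ * r₂ / r) t
      = r * radialDeriv r₁ r₂ U r t := fun r hrr t =>
    (hu.isThe hr₁ hr).2 _ (hu.reflection hr₁ hr hφ) r hrr t
  have hharm := harmonicOnNhd_logCoord hU.contDiffOn hU.laplace
  have hsmooth : ∀ t, ContDiffAt ℝ 2 (fun p : ℝ × ℝ => U p.1 p.2) (ρ, t) := fun t =>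
    hU.contDiffOn.contDiffAt ((isOpen_openStrip r₁ r₂).mem_nhds ⟨hmid, mem_univ _⟩)
  refine Function.Periodic.eq_of_deriv_deriv_eq_zero Real.two_pi_pos
    (h := fun t => U ρ t) (hU.periodic ρ ⟨hmid.1.le, hmid.2.le⟩) ?_ (fun t => ?_) θ θ'
  · exact contDiff_iff_contDiffAt.2 fun t => (hsmooth t).comp t (f := fun t : ℝ => (ρ, t))
      (contDiffAt_const.prodMk contDiffAt_id)
  have hz : (⟨Real.log ρ, t⟩ : ℂ) ∈ logStrip r₁ r₂ := log_mem_logStrip hr₁ hmid t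
  have hL := (hharm _ hz).1.laplacian_eq_deriv_deriv
  rw [(hharm _ hz).2.self_of_nhds] at hL
  set g : ℝ → ℝ := fun s => deriv (fun s' => logCoord U ⟨s', t⟩) s
  have hg : ∀ {s}, Real.exp s ∈ Ioo r₁ r₂ →
      g s = Real.exp s * radialDeriv r₁ r₂ U (Real.exp s) t := fun {s} hs => by
    have hs' : (⟨s, t⟩ : ℂ) ∈ logStrip r₁ r₂ := hs
    have h1 := (((hharm _ hs').1.differentiableAt (by simp)).hasFDerivAt.comp_hasDerivAt s
      (hasDerivAt_complex_mk_re t s)).deriv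
    exact h1.trans (logCoord_mul_radialDeriv hU.contDiffOn hs').symm
  -- Here `g` is `r U_r` in the variable `s = log r`; it is even about `log ρ`, so its derivative
  -- vanishes there.
  have hev : (fun s => g (2 * Real.log ρ - s)) =ᶠ[𝓝 (Real.log ρ)] g := by
    have hopen : IsOpen {s | Real.exp s ∈ Ioo r₁ r₂} := isOpen_Ioo.preimage Real.continuous_exp
    filter_upwards [hopen.mem_nhds (show Real.exp (Real.log ρ) ∈ Ioo r₁ r₂ by
      rwa [Real.exp_log hρ0])] with s hs
    have he : Real.exp (2 * Real.log ρ - s) = r₁ * r₂ / Real.exp s := by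
      rw [Real.exp_sub, two_mul, Real.exp_add, Real.exp_log hρ0, hρ2, sq]
    have hs2 : Real.exp (2 * Real.log ρ - s) ∈ Ioo r₁ r₂ := by
      rw [he]; exact div_mem_Ioo hr₁ hs
    rw [hg hs2, hg hs, he, hsym _ ⟨hs.1.le, hs.2.le⟩]
  have hg0 : deriv g (Real.log ρ) = 0 := by
    have h1 := hev.deriv_eq
    rw [deriv_comp_const_sub, two_mul, add_sub_cancel_right] at h1
    linarith
  simp only [Pi.zero_apply] at hL
  rw [show deriv (fun s => deriv (fun s' => logCoord U ⟨s', t⟩) s) (Real.log ρ) = 0 from hg0,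
    zero_add] at hL
  simpa only [logCoord, Real.exp_log hρ0] using hL.symm

/-! ### Integration along rays -/

theorem integral_mul_radialDeriv {r₁ r₂ : ℝ} (hr₁ : 0 < r₁) (hr : r₁ < r₂) {w : ℝ → ℝ → ℝ}
    (hw : ContDiffOn ℝ 1 (fun p : ℝ × ℝ => w p.1 p.2) (closedStrip r₁ r₂))
    {r s : ℝ} (hrr : r ∈ Icc r₁ r₂) (hs : s ∈ Icc r₁ r₂) (θ : ℝ) :
    ∫ ρ in (s / r)..1, (r * ρ * radialDeriv r₁ r₂ w (r * ρ) θ) / ρ = w r θ - w s θ := by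
  have hr0 := hr₁.trans_le hrr.1
  -- The unordered interval covers both `s ≤ r` and `r ≤ s`.
  have hmem : ∀ ρ ∈ uIcc (s / r) 1, r * ρ ∈ Icc r₁ r₂ := fun ρ hρ => by
    have h1 : r * ρ ∈ uIcc s r := by
      have h2 := mem_image_of_mem (fun x => r * x) hρ
      rwa [image_const_mul_uIcc, mul_div_cancel₀ _ hr0.ne', mul_one] at h2
    exact uIcc_subset_Icc hs hrr h1
  have hcont : ContinuousOn (fun ρ : ℝ => r * ρ) (uIcc (s / r) 1) := by fun_prop
  have hpos : ∀ ρ ∈ uIcc (s / r) 1, ρ ≠ 0 := fun ρ hρ h => by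
    have := (hmem ρ hρ).1
    rw [h, mul_zero] at this
    exact absurd hr₁ this.not_gt
  have hcongr : ∫ ρ in (s / r)..1, (r * ρ * radialDeriv r₁ r₂ w (r * ρ) θ) / ρ
      = ∫ ρ in (s / r)..1, radialDeriv r₁ r₂ w (r * ρ) θ * r := by
    refine intervalIntegral.integral_congr fun ρ hρ => ?_
    have := hpos ρ hρ
    field_simp
  have hline : ContinuousOn (fun ρ : ℝ => (r * ρ, θ)) (uIcc (s / r) 1) :=
    hcont.prodMk continuousOn_const
  have hline' : MapsTo (fun ρ : ℝ => (r * ρ, θ)) (uIcc (s / r) 1) (closedStrip r₁ r₂) :=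
    fun ρ hρ => ⟨hmem ρ hρ, mem_univ _⟩
  have hint : IntervalIntegrable (fun ρ => radialDeriv r₁ r₂ w (r * ρ) θ * r)
      MeasureTheory.volume (s / r) 1 :=
    (((continuousOn_radialDeriv hr hw).comp hline hline').mul
      continuousOn_const).intervalIntegrable
  -- This form of the fundamental theorem asks for the derivative only in the open interval, so `r`
  -- or `s` may lie on an edge of the strip.
  rw [hcongr, intervalIntegral.integral_eq_sub_of_hasDeriv_right (f := fun ρ => w (r * ρ) θ)
    (hw.continuousOn.comp hline hline') (fun ρ hρ => ?_) hint, mul_one, mul_div_cancel₀ _ hr0.ne']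
  have h1 : HasDerivWithinAt (fun x : ℝ => r * x) r (uIcc (s / r) 1) ρ := by
    simpa using (hasDerivWithinAt_id ρ (uIcc (s / r) 1)).const_mul r
  have hρ' : ρ ∈ uIcc (s / r) 1 := Ioo_subset_Icc_self hρ
  have h2 := (hasDerivWithinAt_radialDeriv hw (hmem ρ hρ') θ).comp ρ h1 hmem
  exact (h2.hasDerivAt (Icc_mem_nhds hρ.1 hρ.2)).hasDerivWithinAt

theorem mainTheorem7 (r₁ r₂ : ℝ) (hr₁ : 0 < r₁) (hr : r₁ < r₂) :
    (∀ φ : ℝ → ℝ → ℝ, IsBoundaryData r₁ r₂ φ →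
      (∀ θ : ℝ, r₁ * φ r₁ θ = r₂ * φ r₂ θ) →
      ∀ U : ℝ → ℝ → ℝ, IsNeumannSolution r₁ r₂ φ U → U (Real.sqrt (r₁ * r₂)) 0 = 0 →
        ∃ u : ℝ → ℝ → ℝ,
          IsTheDirichletSolution r₁ r₂ (fun r θ => r * φ r θ) u ∧
          ∀ r ∈ Set.Icc r₁ r₂, ∀ θ : ℝ,
            U r θ = ∫ ρ in (Real.sqrt (r₁ * r₂) / r)..1, u (r * ρ) θ / ρ) ∧
    (∀ φ : ℝ → ℝ → ℝ, IsBoundaryData r₁ r₂ φ →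
      (∫ θ in (0 : ℝ)..(2 * Real.pi), φ r₁ θ) = (∫ θ in (0 : ℝ)..(2 * Real.pi), φ r₂ θ) →
      ∀ U : ℝ → ℝ → ℝ, IsNeumannSolution r₁ r₂ (fun r θ => φ r θ / r) U →
        IsTheDirichletSolution r₁ r₂ φ (fun r θ => r * radialDeriv r₁ r₂ U r θ)) := by
  refine ⟨fun φ _ hφ U hU hU0 => ⟨fun r θ => r * radialDeriv r₁ r₂ U r θ,
    (hU.isDirichletSolution hr₁ hr).isThe hr₁ hr, fun r hrr θ => ?_⟩, fun φ _ _ U hU => ?_⟩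
  · rw [integral_mul_radialDeriv hr₁ hr hU.contDiffOn_closed hrr
      (Ioo_subset_Icc_self (sqrt_mul_mem_Ioo hr₁ hr)) θ, hU.eq_on_middle hr₁ hr hφ θ 0, hU0,
      sub_zero]
  · have h := hU.isDirichletSolution hr₁ hr
    refine IsDirichletSolution.isThe hr₁ hr ⟨h.contDiffOn, h.continuousOn, h.periodic, h.laplace,
      fun r hrr θ => (h.boundary r hrr θ).trans ?_⟩
    have hr0 : r ≠ 0 := by
      rcases hrr with rfl | rfl
      exacts [hr₁.ne', (hr₁.trans hr).ne']
    field_simp
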